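/- Consider a stochastic team with $N$ decision makers (DMs), consisting of: a probability space $(\Omega,\mathcal F,P)$, where $(\Omega,\mathcal F)$ is an arbitrary measurable space; non-empty standard Borel action spaces $(\mathbb U^i,\mathcal U^i)$ and standard Borel measurement spaces $(\mathbb Y^i,\mathcal Y^i)$, $1\le i\le N$, with $\mathbb U:=\prod_i\mathbb U^i$; jointly measurable measurement functions $y^i=\eta^i(\omega,\mathbf u)$, $\eta^i:\Omega\times\mathbb U\to\mathbb Y^i$; a measurable map $\omega\mapsto\omega_0\in\Omega_0$ into a measurable space $\Omega_0$ (the cost- and order-relevant uncertainty); and a measurable cost function $c:\Omega_0\times\mathbb U\to[0,\infty)$. A team policy is a tuple $\gamma=(\gamma^1,\dots,\gamma^N)\in\Gamma$ of measurable maps $\gamma^i:\mathbb Y^i\to\mathbb U^i$. No order of action of the DMs is fixed in advance. Let $\mathscr J^i$ be the $\sigma$-field on $\Omega\times\mathbb U$ generated by $\eta^i$; let $S_k$ be the set of orderings $s=(s_1,\dots,s_k)$ of $k$ distinct DMs and $T_k s=(s_1,\dots,s_k)$ the truncation of a longer ordering; for $s\in S_k$ let $\mathcal P_s(\omega,\mathbf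 u)=(\omega,u^{s_1},\dots,u^{s_k})$ and let $\mathscr F(s)$ be the $\sigma$-field $\mathcal P_s^{-1}(\mathcal F\otimes\mathcal U^{s_1}\otimes\dots\otimes\mathcal U^{s_k})$ on $\Omega\times\mathbb U$. The system has - **Property C** if there is a map $\psi:\Omega\times\mathbb U\to S_N$ such that for all $1\le k\le N$, $s\in S_k$ and $E\in\mathscr J^{s_k}$, $E\cap (T_k\circ\psi)^{-1}(s)\in\mathscr F(T_{k-1}s)$; - **Property CI** if there is a map $\psi:\Omega\times\mathbb U\to S_N$ such that for all $1\le k\le N$ and $(\omega,\mathbf u)\in\Omega\times\mathbb U$, writing $s=\psi(\omega,\mathbf u)$ and $Z=\mathcal P_{T_{k-1}s}^{-1}\big(\mathcal P_{T_{k-1}s}(\omega,\mathbf u)\big)$, one has $E\cap Z\in\{\emptyset,Z\}$ for every $E\in\mathscr J^{s_k}$; - **Property DF** if for every $\gamma\in\Gamma$ and $\omega\in\Omega$ there are an ordering $s\in S_N$ and actions $\mathbf a\in\mathbb U$ such that, for every $k$, $\gamma^{s_k}(\eta^{s_k}(\omega,\mathbf b))=a^{s_k}$ for all $\mathbf b\in\mathbb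 U$ with $b^{s_l}=a^{s_l}$ for $l<k$ (no action depends on actions other than those of its predecessors); - **Property SM** if for every $\gamma\in\Gamma$ and $\omega\in\Omega$ the closed-loop equations $u^i=\gamma^i(\eta^i(\omega,\mathbf u))$, $1\le i\le N$, have exactly one solution $\mathbf u=M^\gamma(\omega)$, and $M^\gamma:\Omega\to\mathbb U$ is measurable. Two systems with the same $N$, $\mathbb U^i$, $\mathbb Y^i$ and $\Omega_0$ (but possibly different probability spaces, measurement functions and maps to $\Omega_0$) are *equivalent* if they have the same cost function and, for every team policy $\gamma\in\Gamma$, both have a unique measurable closed-loop solution $M^\gamma$ as in Property SM, the joint law of $\big(\omega_0,\,(y^i)_i,\,\mathbf u,\,c(\omega_0,\mathbf u)\big)$ under $\gamma$ is the same in both systems, and so is the expected cost. **Theorem.** For every such system: 1. if it has Property CI, then there is an equivalent system which has Property C; 2. Property C implies Property CI; 3. Property CI holds if and only if Property DF holds; 4. Property DF implies Property SM. Thus, with C $\Leftarrow$ CI understood up to equivalence of systems, C $\Leftrightarrow$ CI $\Leftrightarrow$ DF $\Rightarrow$ SM. -/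

import Mathlib

open MeasureTheory
open scoped NNReal ENNReal

universe u v w w₀

/-- `AgentOrder N k` is the set `S_k` of orderings `s = (s_1, …, s_k)` of `k` distinct decision makers
out of `N`. Indices start at `0`, so `s_k` is `s ⟨k - 1, _⟩`. -/
abbrev AgentOrder (N k : ℕ) : Type := Fin k ↪ Fin N

/-- The truncation map `T_j^k : S_k → S_j`, keeping the first `j` decision makers of an ordering. -/
def AgentOrder.trunc {N k j : ℕ} (h : j ≤ k) (s : AgentOrder N k) : AgentOrder N j :=
  (Fin.castLEEmb h).trans s

/-- The set `Γ = ∏ Γ^i` of team policies: tuples of measurable maps from measurements to actions. -/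
abbrev TeamPolicy {N : ℕ} (U : Fin N → Type u) (Y : Fin N → Type v)
    [∀ i, MeasurableSpace (U i)] [∀ i, MeasurableSpace (Y i)] : Type (max u v) :=
  ∀ i, {g : Y i → U i // Measurable g}

/-- A (possibly non-sequential) stochastic team with `N` decision makers, action spaces `U i`,
measurement spaces `Y i`, and cost- and order-relevant uncertainty taking values in `Ω₀`. -/
structure TeamSystem {N : ℕ} (U : Fin N → Type u) (Y : Fin N → Type v) (Ω₀ : Type w₀)
    [∀ i, MeasurableSpace (U i)] [∀ i, MeasurableSpace (Y i)] [MeasurableSpace Ω₀] where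
  /-- the underlying event space -/
  Ω : Type w
  [mΩ : MeasurableSpace Ω]
  /-- the probability measure on the event space -/
  P : Measure Ω
  [isProb : IsProbabilityMeasure P]
  /-- the cost- and order-relevant component of the uncertainty -/
  ω₀ : Ω → Ω₀
  measurable_ω₀ : Measurable ω₀
  /-- the measurement functions `y^i = η^i(ω, u)` -/
  η : ∀ i, Ω × (∀ j, U j) → Y i
  measurable_η : ∀ i, Measurable (η i)
  /-- the cost function -/
  cost : Ω₀ × (∀ j, U j) → ℝ≥0
  measurable_cost : Measurable cost

namespace TeamSystem

attribute [instance] TeamSystem.mΩ TeamSystem.isProb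

variable {N : ℕ} {U : Fin N → Type u} {Y : Fin N → Type v} {Ω₀ : Type w₀}
  [∀ i, MeasurableSpace (U i)] [∀ i, MeasurableSpace (Y i)] [MeasurableSpace Ω₀]

/-- The projection `𝒫_s(ω, u) = (ω, u^{s_1}, …, u^{s_k})`. -/
def proj (S : TeamSystem.{u, v, w, w₀} U Y Ω₀) {k : ℕ} (s : AgentOrder N k)
    (p : S.Ω × (∀ j, U j)) : S.Ω × (∀ i : Fin k, U (s i)) :=
  (p.1, fun i => p.2 (s i))

/-- The information field `𝒥^i` on `Ω × ∏ U^j` induced by the measurement function `η^i`. -/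
abbrev infoField (S : TeamSystem.{u, v, w, w₀} U Y Ω₀) (i : Fin N) :
    MeasurableSpace (S.Ω × (∀ j, U j)) :=
  MeasurableSpace.comap (S.η i) inferInstance

/-- The cylindrical extension `ℱ(s)` of `ℱ ⊗ 𝒰^{s_1} ⊗ ⋯ ⊗ 𝒰^{s_k}` to `Ω × ∏ U^j`. -/
abbrev cylField (S : TeamSystem.{u, v, w, w₀} U Y Ω₀) {k : ℕ} (s : AgentOrder N k) :
    MeasurableSpace (S.Ω × (∀ j, U j)) :=
  MeasurableSpace.comap (S.proj s) inferInstance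

/-- The cylinder `𝒫_s⁻¹(𝒫_s(p))` through the point `p = (ω, u)`. -/
def cyl (S : TeamSystem.{u, v, w, w₀} U Y Ω₀) {k : ℕ} (s : AgentOrder N k)
    (p : S.Ω × (∀ j, U j)) : Set (S.Ω × (∀ j, U j)) :=
  S.proj s ⁻¹' {S.proj s p}

/-- Property C (causality); the `(k+1)`-st decision maker of an ordering is `s (Fin.last k)`. -/
def PropertyC (S : TeamSystem.{u, v, w, w₀} U Y Ω₀) : Prop :=
  ∃ ψ : S.Ω × (∀ j, U j) → AgentOrder N N,
    ∀ (k : ℕ) (hk : k + 1 ≤ N) (s : AgentOrder N (k + 1)) (E : Set (S.Ω × (∀ j, U j))),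
      MeasurableSet[S.infoField (s (Fin.last k))] E →
        MeasurableSet[S.cylField (s.trunc (Nat.le_succ k))] (E ∩ {p | (ψ p).trunc hk = s})

/-- Property CI (causal implementability). -/
def PropertyCI (S : TeamSystem.{u, v, w, w₀} U Y Ω₀) : Prop :=
  ∃ ψ : S.Ω × (∀ j, U j) → AgentOrder N N,
    ∀ (k : Fin N) (p : S.Ω × (∀ j, U j)) (E : Set (S.Ω × (∀ j, U j))),
      MeasurableSet[S.infoField (ψ p k)] E →
        E ∩ S.cyl ((ψ p).trunc k.isLt.le) p = ∅ ∨
          E ∩ S.cyl ((ψ p).trunc k.isLt.le) p = S.cyl ((ψ p).trunc k.isLt.le) p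

/-- Property DF (deadlock-freeness): for every policy and every `ω` the control laws can be ordered,
with resulting actions `a`, so that the action selected by each decision maker is determined once the
actions of its predecessors are in place, whatever all the remaining actions may be. -/
def PropertyDF (S : TeamSystem.{u, v, w, w₀} U Y Ω₀) : Prop :=
  ∀ (γ : TeamPolicy U Y) (ω : S.Ω), ∃ (s : AgentOrder N N) (a : ∀ j, U j),
    ∀ (k : Fin N) (b : ∀ j, U j), (∀ l < k, b (s l) = a (s l)) →
      (γ (s k)).1 (S.η (s k) (ω, b)) = a (s k)

/-- `M` is the measurable solution map of the closed loop under `γ`: for each `ω` the equations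
`u^i = γ^i(η^i(ω, u))` have the solution `u = M ω` and no other. -/
def IsSolutionMap (S : TeamSystem.{u, v, w, w₀} U Y Ω₀) (γ : TeamPolicy U Y)
    (M : S.Ω → ∀ j, U j) : Prop :=
  Measurable M ∧
    ∀ (ω : S.Ω) (a : ∀ j, U j), (∀ i, a i = (γ i).1 (S.η i (ω, a))) ↔ a = M ω

/-- Property SM (solvability-measurability). -/
def PropertySM (S : TeamSystem.{u, v, w, w₀} U Y Ω₀) : Prop :=
  ∀ γ : TeamPolicy U Y, ∃ M : S.Ω → ∀ j, U j, S.IsSolutionMap γ M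

/-- The joint law of `(ω₀, y, u, c(ω₀, u))` when the actions are given by `u = M ω`. -/
noncomputable def law (S : TeamSystem.{u, v, w, w₀} U Y Ω₀) (M : S.Ω → ∀ j, U j) :
    Measure (Ω₀ × (∀ j, Y j) × (∀ j, U j) × ℝ≥0) :=
  S.P.map fun ω => (S.ω₀ ω, fun j => S.η j (ω, M ω), M ω, S.cost (S.ω₀ ω, M ω))

/-- The expected cost when the actions are given by `u = M ω`. -/
noncomputable def expectedCost (S : TeamSystem.{u, v, w, w₀} U Y Ω₀) (M : S.Ω → ∀ j, U j) :
    ℝ≥0∞ :=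
  ∫⁻ ω, (S.cost (S.ω₀ ω, M ω) : ℝ≥0∞) ∂S.P

/-- Equivalence of two systems with the same action and measurement spaces: they have the same cost
function and, under every team policy, both have a well-defined closed-loop solution, and the two
solutions have the same joint law (with `ω₀`) of measurements, actions and cost, and the same
expected cost. -/
def Equivalent (S S' : TeamSystem.{u, v, w, w₀} U Y Ω₀) : Prop :=
  S.cost = S'.cost ∧
    ∀ γ : TeamPolicy U Y, ∃ (M : S.Ω → ∀ j, U j) (M' : S'.Ω → ∀ j, U j),
      S.IsSolutionMap γ M ∧ S'.IsSolutionMap γ M' ∧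
        S.law M = S'.law M' ∧ S.expectedCost M = S'.expectedCost M'

end TeamSystem

/-!
Causality, causal implementability, deadlock-freeness and solvability are compared through a pointwise
notion. Decision maker `i` *can act* after a set `D` at `(ω, u)` (`CanAct`) if its measurement is
constant in the actions outside `D`, and `ω` is *sequenceable* (`Sequenceable`) if for all `u` and all
`D` that do not contain everybody, somebody outside `D` can act. Letting the decision makers act
greedily gives an ordering (`greedyOrder`), so both Property CI and Property DF amount to all `ω` being
sequenceable. The step from DF uses the policies that act as in `u` exactly if the measurement
is the one at `(ω, u)`; the step to DF needs a closed-loop solution, which sequenceability provides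
(`Sequenceable.exists_fixedPoint`).

No measurable ordering is needed for Property SM: under DF the `N`-th iterate of
`u ↦ (γ^i(η^i(ω, u)))_i` from any starting point is the unique solution (`PropertyDF.propertySM`).

Property C asks for a measurable ordering. For a standard Borel event space it exists: for fixed `D` the
sets where `i ∉ D` cannot act are analytic and have no common point, so finite Novikov separation
gives a measurable choice of who acts next (`exists_measurable_next`, `propertyC_of_measurable_next`).
An arbitrary event space enters the measurement functions only through a measurable map `f` into the
Cantor space (`Measurable.exists_eq_comp_prodMap_natBool`). Not every point of the Cantor space need be
sequenceable, but the exceptional set is analytic and missed by `f`; its compact subsets are null for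
the law of `f`, hence so is the set itself
(`MeasureTheory.AnalyticSet.measure_eq_zero_of_isCompact`). Changing the measurement functions over a
measurable null set containing it makes every state sequenceable, and closed-loop solutions change
only on a null set, so the new system is equivalent to the old one and has Property C.
-/

/-! ### Analytic sets: finite separation and nullity -/

theorem MeasureTheory.AnalyticSet.inter {α : Type*} [TopologicalSpace α] [T2Space α] {s t : Set α}
    (hs : AnalyticSet s) (ht : AnalyticSet t) : AnalyticSet (s ∩ t) := by
  rw [Set.inter_eq_iInter]
  exact AnalyticSet.iInter fun b => by cases b <;> assumption

/-- **Novikov's separation theorem** for finite families, relative to an analytic set `C`: analytic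
sets without a common point in `C` have measurable supersets without a common point in `C`. -/
theorem MeasureTheory.AnalyticSet.exists_measurableSet_superset_inter_iInter_eq_empty
    {α ι : Type*} [TopologicalSpace α] [PolishSpace α] [MeasurableSpace α] [BorelSpace α]
    {A : ι → Set α} (hA : ∀ i, AnalyticSet (A i)) (s : Finset ι) {C : Set α}
    (hC : AnalyticSet C) (h : C ∩ ⋂ i ∈ s, A i = ∅) :
    ∃ B : ι → Set α, (∀ i, MeasurableSet (B i)) ∧ (∀ i, A i ⊆ B i) ∧ C ∩ ⋂ i ∈ s, B i = ∅ := by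
  classical
  induction s using Finset.induction_on generalizing C with
  | empty => exact ⟨fun _ => Set.univ, fun _ => .univ, fun _ => Set.subset_univ _, by simpa using h⟩
  | insert a s ha ih =>
    obtain ⟨B, hB, hAB, he⟩ := ih (hC.inter (hA a)) (by
      rw [← h, Finset.set_biInter_insert, Set.inter_assoc])
    have hBs : MeasurableSet (⋂ i ∈ s, B i) := s.measurableSet_biInter fun i _ => hB i
    obtain ⟨V, hAV, hV, hVm⟩ := (hA a).measurablySeparable (hC.inter hBs.analyticSet) (by
      rw [Set.disjoint_iff_inter_eq_empty, ← he]
      ext x; simp only [Set.mem_inter_iff]; tauto)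
    refine ⟨Function.update B a V, fun i => ?_, fun i => ?_, ?_⟩
    · rcases eq_or_ne i a with rfl | hi
      · simpa using hVm
      · simpa [hi] using hB i
    · rcases eq_or_ne i a with rfl | hi
      · simpa using hAV
      · simpa [hi] using hAB i
    · have hs : ⋂ i ∈ s, Function.update B a V i = ⋂ i ∈ s, B i := by
        refine Set.iInter₂_congr fun i hi => ?_
        rw [Function.update_of_ne (ne_of_mem_of_not_mem hi ha)]
      rw [Finset.set_biInter_insert, hs, Function.update_self, ← Set.disjoint_iff_inter_eq_empty]
      rw [Set.disjoint_left] at hV ⊢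
      exact fun x hxC hx => hV ⟨hxC, hx.2⟩ hx.1

/-- The only part of Choquet's capacitability theorem that is needed: an analytic set all of whose
compact subsets are null is itself null. -/
theorem MeasureTheory.AnalyticSet.measure_eq_zero_of_isCompact {α : Type*} [TopologicalSpace α]
    [MeasurableSpace α] {μ : Measure α} [μ.OuterRegular] {A : Set α} (hA : AnalyticSet A)
    (h : ∀ K ⊆ A, IsCompact K → μ K = 0) : μ A = 0 := by
  rw [AnalyticSet] at hA
  rcases hA with rfl | ⟨g, hg, rfl⟩
  · exact measure_empty
  by_contra hpos
  obtain ⟨c, hc0, hc⟩ := exists_between (pos_iff_ne_zero.2 hpos)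
  -- Bounding the coordinates one at a time, keep the outer measure of the image above `c`.
  let C : List ℕ → Set (ℕ → ℕ) := fun l => {σ | ∀ i (hi : i < l.length), σ i ≤ l[i]}
  have step : ∀ l, c < μ (g '' C l) → ∃ n, c < μ (g '' C (l ++ [n])) := by
    intro l hl
    have hmono : Monotone fun n => g '' C (l ++ [n]) := by
      intro n m hnm
      refine Set.image_mono fun σ hσ i hi => ?_
      have := hσ i (by simpa using hi)
      rw [List.getElem_append] at this ⊢
      split_ifs with h' <;> simp_all
      omega
    have hU : g '' C l = ⋃ n, g '' C (l ++ [n]) := by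
      rw [← Set.image_iUnion]
      congr 1
      ext σ
      simp only [Set.mem_iUnion]
      refine ⟨fun hσ => ⟨σ l.length, fun i hi => ?_⟩, fun ⟨n, hσ⟩ i hi => ?_⟩
      · rw [List.getElem_append]
        split_ifs with h'
        · exact hσ i h'
        · have : i = l.length := by simp at hi; omega
          simp [this]
      · have := hσ i (by simp; omega)
        rwa [List.getElem_append_left hi] at this
    rw [hU, hmono.measure_iUnion] at hl
    exact lt_iSup_iff.1 hl
  choose! next hnext using step
  let L : ℕ → List ℕ := fun k => Nat.rec [] (fun _ l => l ++ [next l]) k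
  have hLs : ∀ k, L (k + 1) = L k ++ [next (L k)] := fun _ => rfl
  have hLlen : ∀ k, (L k).length = k := by
    intro k
    induction k with
    | zero => rfl
    | succ k ih => rw [hLs, List.length_append, ih]; rfl
  have hLc : ∀ k, c < μ (g '' C (L k)) := by
    intro k
    induction k with
    | zero =>
      have : C (L 0) = Set.univ := by
        ext σ; simp [C, L]
      rwa [this, Set.image_univ]
    | succ k ih => exact hLs k ▸ hnext _ ih
  let n : ℕ → ℕ := fun k => next (L k)
  have hLn : ∀ k i (hi : i < (L k).length), (L k)[i] = n i := by
    intro k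
    induction k with
    | zero => intro i hi; simp [hLlen] at hi
    | succ k ih =>
      intro i hi
      simp only [hLs, List.getElem_append]
      split_ifs with h'
      · exact ih i h'
      · have : i = k := by simp only [hLlen] at hi h'; omega
        simp [this, n]
  have hCL : ∀ k, C (L k) = {σ | ∀ i < k, σ i ≤ n i} := by
    intro k
    ext σ
    simp only [C, Set.mem_ofPred_eq, hLn, hLlen]
  set K : Set (ℕ → ℕ) := Set.univ.pi fun i => Set.Iic (n i) with hK
  have hKc : IsCompact K := isCompact_univ_pi fun i => (Set.finite_Iic (n i)).isCompact
  have hK0 := h (g '' K) (Set.image_subset_range _ _) (hKc.image hg)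
  obtain ⟨V, hKV, hVo, hVc⟩ := (g '' K).exists_isOpen_lt_of_lt c (hK0 ▸ hc0)
  let := PiNat.metricSpaceNatNat
  obtain ⟨δ, hδ, hKδ⟩ := hKc.exists_thickening_subset_open (hVo.preimage hg)
    (Set.image_subset_iff.1 hKV)
  obtain ⟨k, hk⟩ := exists_pow_lt_of_lt_one hδ (by norm_num : (1 / 2 : ℝ) < 1)
  refine absurd (hLc k) (not_lt.2 ((measure_mono ?_).trans hVc.le))
  rw [hCL, Set.image_subset_iff]
  intro σ hσ
  refine hKδ (Metric.mem_thickening_iff.2 ⟨fun i => if i < k then σ i else 0, ?_, ?_⟩)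
  · intro i _
    by_cases hi : i < k <;> simp [hi, hσ i]
  · refine lt_of_le_of_lt (PiNat.mem_cylinder_iff_dist_le.1 fun i hi => ?_) hk
    simp [hi]

/-! ### Measurable functions on a product factor through a Cantor space -/

/-- Countably many maps into the Cantor space can be recovered from a single one. -/
theorem exists_measurable_natBool_forall_comp_eq {Ω : Type*} [MeasurableSpace Ω]
    {f : ℕ → Ω → ℕ → Bool} (hf : ∀ n, Measurable (f n)) :
    ∃ F : Ω → ℕ → Bool, Measurable F ∧
      ∀ n, ∃ r : (ℕ → Bool) → ℕ → Bool, Measurable r ∧ r ∘ F = f n := by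
  refine ⟨fun ω m => f m.unpair.1 ω m.unpair.2, ?_, fun n => ⟨fun x k => x (Nat.pair n k), ?_, ?_⟩⟩
  · exact measurable_pi_iff.2 fun m => (measurable_pi_apply _).comp (hf _)
  · exact measurable_pi_iff.2 fun m => measurable_pi_apply _
  · ext; simp

theorem MeasurableSet.exists_preimage_prodMap_natBool {Ω V : Type*} [MeasurableSpace Ω]
    [MeasurableSpace V] {E : Set (Ω × V)} (hE : MeasurableSet E) :
    ∃ f : Ω → ℕ → Bool, Measurable f ∧
      ∃ E' : Set ((ℕ → Bool) × V), MeasurableSet E' ∧ Prod.map f id ⁻¹' E' = E := by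
  classical
  rw [← generateFrom_prod] at hE
  induction E, hE using MeasurableSpace.generateFrom_induction with
  | hC E hE _ =>
    obtain ⟨s, hs, t, ht, rfl⟩ := hE
    refine ⟨fun ω _ => decide (ω ∈ s), measurable_pi_iff.2 fun _ => ?_,
      {x | x 0 = true} ×ˢ t, ?_, ?_⟩
    · exact measurable_to_bool (by simpa [Set.preimage] using hs)
    · exact (measurableSet_eq_fun (measurable_pi_apply 0) measurable_const).prod ht
    · ext; simp
  | empty => exact ⟨fun _ _ => true, measurable_const, ∅, .empty, rfl⟩
  | compl E _ ih =>
    obtain ⟨f, hf, E', hE', rfl⟩ := ih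
    exact ⟨f, hf, E'ᶜ, hE'.compl, rfl⟩
  | iUnion E _ ih =>
    choose f hf E' hE' hfE using ih
    obtain ⟨F, hF, hr⟩ := exists_measurable_natBool_forall_comp_eq hf
    choose r hr hrF using hr
    refine ⟨F, hF, ⋃ n, Prod.map (r n) id ⁻¹' E' n,
      .iUnion fun n => ((hr n).prodMap measurable_id) (hE' n), ?_⟩
    simp only [Set.preimage_iUnion, ← Set.preimage_comp, Prod.map_comp_map, hrF, Function.id_comp, hfE]

/-- A measurable function on `Ω × V` with standard Borel values sees `Ω` only through a map into
the Cantor space, however large the `σ`-algebra of `Ω` is. -/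
theorem Measurable.exists_eq_comp_prodMap_natBool {Ω V Y : Type*} [MeasurableSpace Ω]
    [MeasurableSpace V] [MeasurableSpace Y] [StandardBorelSpace Y] [Nonempty Y]
    {η : Ω × V → Y} (hη : Measurable η) :
    ∃ f : Ω → ℕ → Bool, Measurable f ∧
      ∃ h : (ℕ → Bool) × V → Y, Measurable h ∧ η = h ∘ Prod.map f id := by
  have hgen := MeasurableSpace.measurableSet_natGeneratingSequence (α := Y)
  choose f hf E' hE' hfE using fun n => (hη (hgen n)).exists_preimage_prodMap_natBool
  obtain ⟨F, hF, hr⟩ := exists_measurable_natBool_forall_comp_eq hf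
  choose r hr hrF using hr
  refine ⟨F, hF, Measurable.exists_eq_measurable_comp (f := Prod.map F id) (g := η) ?_⟩
  have key : @Measurable _ _ (MeasurableSpace.comap (Prod.map F (id : V → V)) inferInstance)
      (MeasurableSpace.generateFrom (Set.range (MeasurableSpace.natGeneratingSequence Y))) η := by
    refine @measurable_generateFrom _ _ (_) _ _ ?_
    rintro _ ⟨n, rfl⟩
    refine ⟨Prod.map (r n) id ⁻¹' E' n, ((hr n).prodMap measurable_id) (hE' n), ?_⟩
    rw [← hfE, ← Set.preimage_comp, Prod.map_comp_map, hrF, Function.id_comp]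
  rwa [MeasurableSpace.generateFrom_natGeneratingSequence] at key

/-! ### Decision makers that can act after a given set of predecessors -/

section Sequencing

variable {N : ℕ} {U : Fin N → Type u} {Y : Fin N → Type v} {X : Type w}

/-- After the decision makers in `D` have acted as prescribed by `p = (x, u)`, the measurement of `i`
no longer depends on any action that is still open, so that `i` can act next. -/
def CanAct (η : ∀ i, X × (∀ j, U j) → Y i) (p : X × (∀ j, U j)) (D : Finset (Fin N)) (i : Fin N) :
    Prop :=
  ∀ b : ∀ j, U j, (∀ j ∈ D, b j = p.2 j) → η i (p.1, b) = η i p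

/-- The state `x` never deadlocks: whichever decision makers have acted, and in whatever way, one of
the others can act next. -/
def Sequenceable (η : ∀ i, X × (∀ j, U j) → Y i) (x : X) : Prop :=
  ∀ (u : ∀ j, U j) (D : Finset (Fin N)), D ≠ Finset.univ → ∃ i ∉ D, CanAct η (x, u) D i

/-- The decision makers that have acted after `k` steps when `next D` acts after those in `D`. -/
def greedySet (next : Finset (Fin N) → Fin N) : ℕ → Finset (Fin N)
  | 0 => ∅
  | k + 1 => insert (next (greedySet next k)) (greedySet next k)

theorem greedySet_mono (next : Finset (Fin N) → Fin N) : Monotone (greedySet next) :=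
  monotone_nat_of_le_succ fun _ => Finset.subset_insert _ _

theorem card_greedySet_le (next : Finset (Fin N) → Fin N) (k : ℕ) :
    (greedySet next k).card ≤ k := by
  induction k with
  | zero => simp [greedySet]
  | succ k ih => exact (Finset.card_insert_le _ _).trans (by omega)

theorem next_greedySet_notMem {next : Finset (Fin N) → Fin N}
    (h : ∀ D, D ≠ Finset.univ → next D ∉ D) {k : ℕ} (hk : k < N) :
    next (greedySet next k) ∉ greedySet next k := by
  refine h _ fun he => ?_
  have := card_greedySet_le next k
  rw [he, Finset.card_univ, Fintype.card_fin] at this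
  omega

/-- The ordering in which `next D` acts after the decision makers in `D`. -/
def greedyOrder (next : Finset (Fin N) → Fin N) (h : ∀ D, D ≠ Finset.univ → next D ∉ D) :
    AgentOrder N N where
  toFun k := next (greedySet next k)
  inj' := by
    have aux : ∀ k l : Fin N, k < l → next (greedySet next k) ≠ next (greedySet next l) := by
      intro k l hkl he
      refine next_greedySet_notMem h l.2 (he ▸ ?_)
      exact greedySet_mono next (Nat.succ_le_of_lt hkl) (Finset.mem_insert_self _ _)
    intro k l he
    rcases lt_trichotomy k l with hkl | hkl | hkl
    · exact absurd he (aux k l hkl)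
    · exact hkl
    · exact absurd he.symm (aux l k hkl)

/-- The decision makers preceding position `j` in an ordering. -/
def predecessors {k : ℕ} (s : AgentOrder N k) (j : Fin k) : Finset (Fin N) :=
  (Finset.Iio j).map s

theorem mem_predecessors {k : ℕ} {s : AgentOrder N k} {j : Fin k} {i : Fin N} :
    i ∈ predecessors s j ↔ ∃ l < j, s l = i := by
  simp [predecessors]

theorem greedySet_eq_predecessors (next : Finset (Fin N) → Fin N) {k : ℕ} (s : AgentOrder N k)
    (j : Fin k) (h : ∀ l < j, s l = next (greedySet next l)) :
    greedySet next j = predecessors s j := by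
  have aux : ∀ m (hm : m ≤ j.1) i, i ∈ greedySet next m ↔
      ∃ l : Fin k, l.1 < m ∧ s l = i := by
    intro m
    induction m with
    | zero => simp [greedySet]
    | succ m ih =>
      intro hm i
      have hsm := h ⟨m, by omega⟩ (Fin.lt_def.2 (by simpa using hm))
      rw [greedySet, Finset.mem_insert, ih (by omega), ← hsm]
      constructor
      · rintro (rfl | ⟨l, hl, rfl⟩)
        · exact ⟨_, Nat.lt_succ_self m, rfl⟩
        · exact ⟨l, by omega, rfl⟩
      · rintro ⟨l, hl, rfl⟩
        rcases Nat.lt_succ_iff_lt_or_eq.1 hl with hl | hl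
        · exact .inr ⟨l, hl, rfl⟩
        · exact .inl (congrArg s (Fin.ext hl))
  ext i
  rw [aux j le_rfl, mem_predecessors]
  rfl

theorem greedyOrder_apply (next : Finset (Fin N) → Fin N)
    (h : ∀ D, D ≠ Finset.univ → next D ∉ D) (k : Fin N) :
    greedyOrder next h k = next (predecessors (greedyOrder next h) k) := by
  rw [← greedySet_eq_predecessors next (greedyOrder next h) k fun _ _ => rfl]
  rfl

theorem predecessors_ne_univ {k : ℕ} (s : AgentOrder N k) (j : Fin k) :
    predecessors s j ≠ Finset.univ := by
  intro he
  obtain ⟨l, hl, hl'⟩ := mem_predecessors.1 (he ▸ Finset.mem_univ (s j))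
  exact hl.ne (s.injective hl')

/-- An initial segment of the greedy ordering is characterised step by step. -/
theorem trunc_greedyOrder_eq_iff (next : Finset (Fin N) → Fin N)
    (h : ∀ D, D ≠ Finset.univ → next D ∉ D) {k : ℕ} (hk : k ≤ N) (s : AgentOrder N k) :
    (greedyOrder next h).trunc hk = s ↔ ∀ j, next (predecessors s j) = s j := by
  have hval : ∀ j, (greedyOrder next h).trunc hk j = next (greedySet next j) := fun _ => rfl
  constructor
  · rintro rfl j
    rw [← greedySet_eq_predecessors next _ j fun l _ => hval l, hval]
  · intro hs
    have aux : ∀ j : Fin k, s j = next (greedySet next j) := by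
      intro j
      induction j using WellFoundedLT.induction with
      | ind j ih => rw [greedySet_eq_predecessors next s j ih, hs]
    exact DFunLike.ext _ _ fun j => (hval j).trans (aux j).symm

/-- If `x` never deadlocks, then at every `(x, u)` the decision makers can be
ordered so that each measurement depends only on the actions of the predecessors. -/
theorem Sequenceable.exists_order {η : ∀ i, X × (∀ j, U j) → Y i} {x : X} (h : Sequenceable η x)
    (u : ∀ j, U j) :
    ∃ s : AgentOrder N N, ∀ k, CanAct η (x, u) (predecessors s k) (s k) := by
  rcases isEmpty_or_nonempty (Fin N) with hN | hN
  · exact ⟨Function.Embedding.refl _, fun k => isEmptyElim k⟩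
  choose! next hnext hact using h u
  refine ⟨greedyOrder next hnext, fun k => ?_⟩
  rw [greedyOrder_apply]
  exact hact _ (predecessors_ne_univ _ _)

/-- In a state without deadlocks the closed loop has a solution: start anywhere and let the decision
makers act one after the other, each as soon as its measurement is determined. -/
theorem Sequenceable.exists_fixedPoint [∀ i, Nonempty (U i)] {η : ∀ i, X × (∀ j, U j) → Y i} {x : X}
    (h : Sequenceable η x) (γ : ∀ i, Y i → U i) :
    ∃ a : ∀ j, U j, ∀ i, γ i (η i (x, a)) = a i := by
  classical
  have key : ∀ m ≤ N, ∃ (D : Finset (Fin N)) (a : ∀ j, U j), D.card = m ∧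
      ∀ i ∈ D, ∀ b : ∀ j, U j, (∀ j ∈ D, b j = a j) → γ i (η i (x, b)) = a i := by
    intro m
    induction m with
    | zero => exact fun _ => ⟨∅, fun _ => Classical.arbitrary _, by simp⟩
    | succ m ih =>
      intro hm
      obtain ⟨D, a, hD, ha⟩ := ih (by omega)
      obtain ⟨i, hi, hact⟩ := h a D (by
        rintro rfl
        rw [Finset.card_univ, Fintype.card_fin] at hD
        omega)
      refine ⟨insert i D, Function.update a i (γ i (η i (x, a))),
        by rw [Finset.card_insert_of_notMem hi, hD], fun j hj b hb => ?_⟩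
      have hbD : ∀ l ∈ D, b l = a l := fun l hl => by
        rw [hb l (Finset.mem_insert_of_mem hl), Function.update_of_ne (ne_of_mem_of_not_mem hl hi)]
      rcases Finset.mem_insert.1 hj with rfl | hj
      · rw [hact b hbD, Function.update_self]
      · rw [ha j hj b hbD, Function.update_of_ne (ne_of_mem_of_not_mem hj hi)]
  obtain ⟨D, a, hD, ha⟩ := key N le_rfl
  obtain rfl := Finset.card_eq_iff_eq_univ D |>.1 (by simpa using hD)
  exact ⟨a, fun i => ha i (Finset.mem_univ i) a fun _ _ => rfl⟩

end Sequencing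

/-! ### Causal implementability, deadlock-freeness and solvability -/

namespace TeamSystem

variable {N : ℕ} {U : Fin N → Type u} {Y : Fin N → Type v} {Ω₀ : Type w₀}
  [∀ i, MeasurableSpace (U i)] [∀ i, MeasurableSpace (Y i)] [MeasurableSpace Ω₀]

theorem mem_cyl_iff {S : TeamSystem.{u, v, w, w₀} U Y Ω₀} {k : ℕ} {s : AgentOrder N k}
    {p q : S.Ω × (∀ j, U j)} : q ∈ S.cyl s p ↔ q.1 = p.1 ∧ ∀ i, q.2 (s i) = p.2 (s i) := by
  simp [cyl, proj, funext_iff]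

/-- The ordering map of Property C also witnesses Property CI: the sets in `ℱ(s)` are unions of
cylinders. -/
theorem PropertyC.propertyCI {S : TeamSystem.{u, v, w, w₀} U Y Ω₀} (h : S.PropertyC) :
    S.PropertyCI := by
  obtain ⟨ψ, hψ⟩ := h
  refine ⟨ψ, fun k p E hE => ?_⟩
  set s := (ψ p).trunc (Nat.succ_le_of_lt k.2) with hs
  have hmem : ∀ q ∈ S.cyl ((ψ p).trunc k.isLt.le) p, ∀ F, MeasurableSet[S.infoField (ψ p k)] F →
      (q ∈ F ∩ {q | (ψ q).trunc (Nat.succ_le_of_lt k.2) = s} ↔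
        p ∈ F ∩ {q | (ψ q).trunc (Nat.succ_le_of_lt k.2) = s}) := by
    intro q hq F hF
    obtain ⟨G, -, hG⟩ := hψ k (Nat.succ_le_of_lt k.2) s F hF
    have hpq : S.proj (s.trunc (Nat.le_succ k)) q = S.proj (s.trunc (Nat.le_succ k)) p := hq
    rw [← hG, Set.mem_preimage, Set.mem_preimage, hpq]
  -- Taking the whole space as event shows that the ordering is the same on all of the cylinder.
  have hord : ∀ q ∈ S.cyl ((ψ p).trunc k.isLt.le) p,
      (ψ q).trunc (Nat.succ_le_of_lt k.2) = s := fun q hq =>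
    ((hmem q hq Set.univ .univ).2 ⟨trivial, rfl⟩).2
  have hE' : ∀ q ∈ S.cyl ((ψ p).trunc k.isLt.le) p, q ∈ E ↔ p ∈ E := fun q hq =>
    ⟨fun hqE => ((hmem q hq E hE).1 ⟨hqE, hord q hq⟩).1,
      fun hpE => ((hmem q hq E hE).2 ⟨hpE, rfl⟩).1⟩
  by_cases hp : p ∈ E
  · exact .inr (Set.inter_eq_right.2 fun q hq => (hE' q hq).2 hp)
  · refine .inl (Set.eq_empty_of_forall_notMem fun q hq => hp ((hE' q hq.2).1 hq.1))

theorem PropertyCI.sequenceable [∀ i, MeasurableSingletonClass (Y i)]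
    {S : TeamSystem.{u, v, w, w₀} U Y Ω₀} (h : S.PropertyCI) (ω : S.Ω) :
    Sequenceable S.η ω := by
  obtain ⟨ψ, hψ⟩ := h
  intro u D hD
  set s := ψ (ω, u) with hs
  -- The first decision maker of the ordering at `(ω, u)` that is not in `D` can act next.
  have hne : ∃ k, s k ∉ D := by
    obtain ⟨i, hi⟩ : ∃ i, i ∉ D := by
      by_contra! hall
      exact hD (Finset.eq_univ_iff_forall.2 hall)
    obtain ⟨k, rfl⟩ := (Finite.injective_iff_surjective.1 s.injective) i
    exact ⟨k, hi⟩
  obtain ⟨k, hk, hmin⟩ := exists_minimal_of_wellFoundedLT (fun k => s k ∉ D) hne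
  refine ⟨s k, hk, fun b hb => ?_⟩
  have hbc : (ω, b) ∈ S.cyl (s.trunc k.isLt.le) (ω, u) := by
    refine mem_cyl_iff.2 ⟨rfl, fun i => hb _ ?_⟩
    by_contra hi
    have := hmin (y := Fin.castLE k.isLt.le i) hi (Fin.le_def.2 (by simp))
    exact absurd (Fin.le_def.1 this) (by simp)
  have huc : (ω, u) ∈ S.cyl (s.trunc k.isLt.le) (ω, u) := mem_cyl_iff.2 ⟨rfl, fun _ => rfl⟩
  rcases hψ k (ω, u) (S.η (s k) ⁻¹' {S.η (s k) (ω, u)})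
    ⟨_, measurableSet_singleton _, rfl⟩ with h0 | h1
  · exact absurd (h0 ▸ ⟨rfl, huc⟩ : (ω, u) ∈ (∅ : Set (S.Ω × (∀ j, U j)))) id
  · exact (h1.ge hbc).1

theorem propertyCI_of_sequenceable {S : TeamSystem.{u, v, w, w₀} U Y Ω₀}
    (h : ∀ ω, Sequenceable S.η ω) : S.PropertyCI := by
  choose ψ hψ using fun p : S.Ω × (∀ j, U j) => (h p.1).exists_order p.2
  refine ⟨ψ, fun k p E hE => ?_⟩
  obtain ⟨H, -, rfl⟩ := hE
  have hconst : ∀ q ∈ S.cyl ((ψ p).trunc k.isLt.le) p, S.η (ψ p k) q = S.η (ψ p k) p := by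
    rintro ⟨ω, b⟩ hq
    rw [mem_cyl_iff] at hq
    obtain rfl : ω = p.1 := hq.1
    refine hψ p k b fun j hj => ?_
    obtain ⟨l, hl, rfl⟩ := mem_predecessors.1 hj
    exact hq.2 ⟨l, hl⟩
  by_cases hp : S.η (ψ p k) p ∈ H
  · exact .inr (Set.inter_eq_right.2 fun q hq => by rwa [Set.mem_preimage, hconst q hq])
  · refine .inl (Set.eq_empty_of_forall_notMem fun q hq => hp ?_)
    rw [← hconst q hq.2]
    exact hq.1

theorem propertyDF_of_sequenceable [∀ i, Nonempty (U i)] {S : TeamSystem.{u, v, w, w₀} U Y Ω₀}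
    (h : ∀ ω, Sequenceable S.η ω) : S.PropertyDF := by
  intro γ ω
  obtain ⟨a, ha⟩ := (h ω).exists_fixedPoint fun i => (γ i).1
  obtain ⟨s, hs⟩ := (h ω).exists_order a
  refine ⟨s, a, fun k b hb => ?_⟩
  rw [hs k b, ha]
  intro j hj
  obtain ⟨l, hl, rfl⟩ := mem_predecessors.1 hj
  exact hb l hl

/-- Deadlock-freeness is tested at `(ω, u)` by the policy under which every decision maker acts as in
`u` exactly if its measurement is the one it has at `(ω, u)`. Decision makers with a single action
cannot reveal their measurement in this way, but nobody needs to wait for them. -/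
theorem PropertyDF.sequenceable [∀ i, MeasurableSingletonClass (Y i)]
    {S : TeamSystem.{u, v, w, w₀} U Y Ω₀} (h : S.PropertyDF) (ω : S.Ω) :
    Sequenceable S.η ω := by
  classical
  intro u D hD
  have hex : ∀ i, ∃ v : U i, Nontrivial (U i) → v ≠ u i := fun i => by
    by_cases hU : Nontrivial (U i)
    · exact (exists_ne (u i)).imp fun v hv _ => hv
    · exact ⟨u i, fun h' => absurd h' hU⟩
  choose v hv using hex
  let γ : TeamPolicy U Y := fun i => ⟨fun y => if y = S.η i (ω, u) then u i else v i,
    Measurable.ite (measurableSet_singleton _) measurable_const measurable_const⟩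
  obtain ⟨s, a, hsa⟩ := h γ ω
  -- Since `u` is a closed-loop solution, the actions `a` coincide with `u`.
  have hau : ∀ k, a (s k) = u (s k) := by
    intro k
    induction k using WellFoundedLT.induction with
    | ind k ih =>
      rw [← hsa k u fun l hl => (ih l hl).symm]
      exact if_pos rfl
  by_cases hne : ∃ k, s k ∉ D ∧ Nontrivial (U (s k))
  · obtain ⟨k, hk, hmin⟩ := exists_minimal_of_wellFoundedLT
      (fun k => s k ∉ D ∧ Nontrivial (U (s k))) hne
    refine ⟨s k, hk.1, fun b hb => ?_⟩
    have hγ := hsa k b fun l hl => by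
      rw [hau]
      by_cases hlD : s l ∈ D
      · exact hb _ hlD
      · have : ¬ Nontrivial (U (s l)) := fun hU => (hmin ⟨hlD, hU⟩ hl.le).not_gt hl
        rw [not_nontrivial_iff_subsingleton] at this
        exact Subsingleton.elim _ _
    rw [hau] at hγ
    by_contra hη
    exact hv (s k) hk.2 ((if_neg hη).symm.trans hγ)
  · obtain ⟨i, hi⟩ : ∃ i, i ∉ D := by
      by_contra! hall
      exact hD (Finset.eq_univ_iff_forall.2 hall)
    refine ⟨i, hi, fun b hb => ?_⟩
    -- All open actions are forced, so that `b` and `u` agree.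
    obtain rfl : b = u := by
      funext j
      by_cases hj : j ∈ D
      · exact hb j hj
      · obtain ⟨k, rfl⟩ := (Finite.injective_iff_surjective.1 s.injective) j
        have : ¬ Nontrivial (U (s k)) := fun hU => hne ⟨k, hj, hU⟩
        rw [not_nontrivial_iff_subsingleton] at this
        exact Subsingleton.elim _ _
    rfl

/-- Under deadlock-freeness the simultaneous best-reply iteration `u ↦ (γ^i(η^i(ω, u)))_i` fixes one
more action in each step, whatever the ordering. Hence its `N`-th iterate from an arbitrary starting
point is the solution map, and it is measurable although the ordering need not depend measurably
on `ω`. -/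
theorem PropertyDF.propertySM [∀ i, Nonempty (U i)] {S : TeamSystem.{u, v, w, w₀} U Y Ω₀}
    (h : S.PropertyDF) : S.PropertySM := by
  intro γ
  let F : S.Ω × (∀ j, U j) → ∀ j, U j := fun p i => (γ i).1 (S.η i p)
  have hF : Measurable F := measurable_pi_iff.2 fun i => (γ i).2.comp (S.measurable_η i)
  let M : ℕ → S.Ω → ∀ j, U j := fun n =>
    Nat.rec (fun _ _ => Classical.arbitrary _) (fun _ f ω => F (ω, f ω)) n
  have hMs : ∀ n ω, M (n + 1) ω = F (ω, M n ω) := fun _ _ => rfl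
  refine ⟨M N, ?_, fun ω a => ?_⟩
  · suffices hM : ∀ n, Measurable (M n) from hM N
    intro n
    induction n with
    | zero => exact measurable_const
    | succ n ih => exact hF.comp (measurable_id.prodMk ih)
  · obtain ⟨s, c, hsc⟩ := h γ ω
    have hsurj := Finite.injective_iff_surjective.1 s.injective
    have hMc : ∀ n, ∀ k : Fin N, k.1 < n → M n ω (s k) = c (s k) := by
      intro n
      induction n with
      | zero => simp
      | succ n ih =>
        intro k hk
        rw [hMs]
        exact hsc k _ fun l hl => ih l (by have := Fin.lt_def.1 hl; omega)
    have hMN : M N ω = c := by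
      funext j
      obtain ⟨k, rfl⟩ := hsurj j
      exact hMc N k k.2
    rw [hMN]
    constructor
    · intro ha
      have hac : ∀ k, a (s k) = c (s k) := by
        intro k
        induction k using WellFoundedLT.induction with
        | ind k ih => rw [ha (s k), hsc k a ih]
      funext j
      obtain ⟨k, rfl⟩ := hsurj j
      exact hac k
    · rintro rfl j
      obtain ⟨k, rfl⟩ := hsurj j
      exact (hsc k a fun _ _ => rfl).symm

end TeamSystem

/-! ### Measurable choice of the next decision maker -/

section MeasurableSequencing

variable {N : ℕ} {U : Fin N → Type u} {Y : Fin N → Type v} {X : Type w}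

/-- It suffices to compare all completions of the actions in `D` with one completion `c` that does not
depend on `p`. This makes the set of `p` where `i` cannot act a projection of a measurable set. -/
theorem canAct_of_forall_piecewise_eq {η : ∀ i, X × (∀ j, U j) → Y i} {p : X × (∀ j, U j)}
    {D : Finset (Fin N)} {i : Fin N} (c : ∀ j, U j)
    (h : ∀ b, η i (p.1, D.piecewise p.2 b) = η i (p.1, D.piecewise p.2 c)) : CanAct η p D i := by
  have aux : ∀ b : ∀ j, U j, (∀ j ∈ D, b j = p.2 j) → D.piecewise p.2 b = b := fun b hb => by
    funext j
    by_cases hj : j ∈ D <;> simp [hj, hb]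
  intro b hb
  have h1 := h b
  have h2 := h p.2
  rw [aux b hb] at h1
  rw [aux p.2 fun _ _ => rfl] at h2
  exact h1.trans h2.symm

theorem CanAct.piecewise_eq {η : ∀ i, X × (∀ j, U j) → Y i} {p : X × (∀ j, U j)}
    {D : Finset (Fin N)} {i : Fin N} (h : CanAct η p D i) (b c : ∀ j, U j) :
    η i (p.1, D.piecewise p.2 b) = η i (p.1, D.piecewise p.2 c) := by
  rw [h (D.piecewise p.2 b) fun j hj => by simp [hj],
    h (D.piecewise p.2 c) fun j hj => by simp [hj]]

theorem CanAct.of_agree {η : ∀ i, X × (∀ j, U j) → Y i} {x : X} {u u' : ∀ j, U j}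
    {D : Finset (Fin N)} {i : Fin N} (h : CanAct η (x, u) D i) (hu : ∀ j ∈ D, u' j = u j) :
    CanAct η (x, u') D i := fun b hb =>
  (h b fun j hj => (hb j hj).trans (hu j hj)).trans (h u' hu).symm

theorem measurable_finset_piecewise {V : Type*} [MeasurableSpace V] [∀ i, MeasurableSpace (U i)]
    (D : Finset (Fin N)) {f g : V → ∀ j, U j} (hf : Measurable f) (hg : Measurable g) :
    Measurable fun p => D.piecewise (f p) (g p) := by
  refine measurable_pi_iff.2 fun j => ?_
  by_cases hj : j ∈ D
  · simpa [hj, Function.comp_def] using (measurable_pi_apply j).comp hf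
  · simpa [hj, Function.comp_def] using (measurable_pi_apply j).comp hg

variable [MeasurableSpace X] [∀ i, MeasurableSpace (U i)] [∀ i, MeasurableSpace (Y i)]
  [∀ i, StandardBorelSpace (Y i)] [TopologicalSpace X] [PolishSpace X] [BorelSpace X]
  [∀ i, TopologicalSpace (U i)] [∀ i, PolishSpace (U i)] [∀ i, BorelSpace (U i)]

theorem analyticSet_not_canAct [∀ i, Nonempty (U i)] {η : ∀ i, X × (∀ j, U j) → Y i}
    (hη : ∀ i, Measurable (η i)) (D : Finset (Fin N)) (i : Fin N) :
    AnalyticSet {p | ¬ CanAct η p D i} := by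
  let c : ∀ j, U j := fun _ => Classical.arbitrary _
  have himg : {p | ¬ CanAct η p D i} = Prod.fst '' {q : (X × (∀ j, U j)) × (∀ j, U j) |
      η i (q.1.1, D.piecewise q.1.2 q.2) = η i (q.1.1, D.piecewise q.1.2 c)}ᶜ := by
    ext p
    constructor
    · intro hp
      by_contra hno
      refine hp (canAct_of_forall_piecewise_eq c fun b => ?_)
      by_contra hb
      exact hno ⟨(p, b), hb, rfl⟩
    · rintro ⟨⟨p, b⟩, hb, rfl⟩ hp
      exact hb (hp.piecewise_eq b c)
  rw [himg]
  refine (MeasurableSet.compl ?_).analyticSet_image measurable_fst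
  exact measurableSet_eq_fun
    ((hη i).comp (measurable_fst.fst.prodMk
      (measurable_finset_piecewise D measurable_fst.snd measurable_snd)))
    ((hη i).comp (measurable_fst.fst.prodMk
      (measurable_finset_piecewise D measurable_fst.snd measurable_const)))

theorem analyticSet_not_sequenceable [∀ i, Nonempty (U i)] {η : ∀ i, X × (∀ j, U j) → Y i}
    (hη : ∀ i, Measurable (η i)) : AnalyticSet {x | ¬ Sequenceable η x} := by
  have hunion : {x | ¬ Sequenceable η x} = ⋃ D : {D : Finset (Fin N) // D ≠ Finset.univ},
      Prod.fst '' ⋂ i : {i // i ∉ D.1}, {p | ¬ CanAct η p D.1 i} := by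
    ext x
    simp only [Sequenceable, Set.mem_ofPred_eq, Set.mem_iUnion, Set.mem_image, Set.mem_iInter]
    push Not
    constructor
    · rintro ⟨u, D, hD, h⟩
      exact ⟨⟨D, hD⟩, (x, u), fun i => h i i.2, rfl⟩
    · rintro ⟨D, ⟨x', u⟩, h, rfl⟩
      exact ⟨u, D, D.2, fun i hi => h ⟨i, hi⟩⟩
  rw [hunion]
  refine AnalyticSet.iUnion fun D => AnalyticSet.image_of_continuous ?_ continuous_fst
  have : Nonempty {i // i ∉ D.1} := by
    by_contra hne
    exact D.2 (Finset.eq_univ_iff_forall.2 fun i => by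
      by_contra hi
      exact hne ⟨⟨i, hi⟩⟩)
  exact AnalyticSet.iInter fun i => analyticSet_not_canAct hη _ _

/-- If no state deadlocks, the decision maker acting next can be chosen as a measurable function of
the state and of the past actions. The sets where the various `i ∉ D` cannot act are analytic and have
no common point, so Novikov's theorem encloses them in measurable sets without a common point. -/
theorem exists_measurable_next [Nonempty (Fin N)] [∀ i, Nonempty (U i)]
    {η : ∀ i, X × (∀ j, U j) → Y i} (hη : ∀ i, Measurable (η i)) (h : ∀ x, Sequenceable η x) :
    ∃ next : Finset (Fin N) → X × (∀ j, U j) → Fin N,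
      (∀ D, Measurable (next D)) ∧
      (∀ D x u u', (∀ j ∈ D, u' j = u j) → next D (x, u') = next D (x, u)) ∧
      ∀ D, D ≠ Finset.univ → ∀ p, next D p ∉ D ∧ CanAct η p D (next D p) := by
  classical
  let c : ∀ j, U j := fun _ => Classical.arbitrary _
  -- Resetting the open actions to `c` makes the enclosing sets cylinders over the actions in `D`.
  let R : Finset (Fin N) → X × (∀ j, U j) → X × (∀ j, U j) := fun D p => (p.1, D.piecewise p.2 c)
  have hR : ∀ D, Measurable (R D) := fun D =>
    measurable_fst.prodMk (measurable_finset_piecewise D measurable_snd measurable_const)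
  have hsep : ∀ D : Finset (Fin N), ∃ B : Fin N → Set (X × (∀ j, U j)),
      (∀ i, MeasurableSet (B i)) ∧ (∀ i, {p | ¬ CanAct η p D i} ⊆ B i) ∧
        (D ≠ Finset.univ → Set.univ ∩ ⋂ i ∈ Dᶜ, B i = ∅) := by
    intro D
    by_cases hD : D = Finset.univ
    · exact ⟨fun _ => Set.univ, fun _ => .univ, fun _ => Set.subset_univ _, fun h' => absurd hD h'⟩
    obtain ⟨B, hB, hAB, he⟩ := AnalyticSet.exists_measurableSet_superset_inter_iInter_eq_empty
      (fun i => analyticSet_not_canAct hη D i) Dᶜ MeasurableSet.univ.analyticSet (by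
        refine Set.eq_empty_of_forall_notMem fun p hp => ?_
        obtain ⟨i, hi, hact⟩ := h p.1 p.2 D hD
        exact Set.mem_iInter₂.1 hp.2 i (Finset.mem_compl.2 hi) hact)
    exact ⟨B, hB, hAB, fun _ => he⟩
  choose B hB hAB hBe using hsep
  have hg : ∃ g : (Fin N → Prop) → Fin N, ∀ Q : Fin N → Prop, (∃ i, Q i) → Q (g Q) := by
    choose! g hg using fun (Q : Fin N → Prop) (hQ : ∃ i, Q i) => hQ
    exact ⟨g, hg⟩
  obtain ⟨g, hg⟩ := hg
  refine ⟨fun D p => g fun i => i ∉ D ∧ R D p ∉ B D i, fun D => ?_, fun D x u u' hu => ?_,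
    fun D hD p => ?_⟩
  · refine (measurable_of_countable g).comp (measurable_pi_iff.2 fun i => ?_)
    exact measurable_const.and (hR D (hB D i).compl).mem
  · have : R D (x, u') = R D (x, u) := by
      refine Prod.ext rfl (funext fun j => ?_)
      by_cases hj : j ∈ D <;> simp [R, hj, hu]
    simp only [this]
  · have hex : ∃ i, i ∉ D ∧ R D p ∉ B D i := by
      by_contra! hall
      refine (Set.notMem_empty (R D p)) (hBe D hD ▸ ⟨trivial, Set.mem_iInter₂.2 fun i hi => ?_⟩)
      exact hall i (Finset.mem_compl.1 hi)
    have hspec := hg (fun i => i ∉ D ∧ R D p ∉ B D i) hex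
    refine ⟨hspec.1, ?_⟩
    have hact : CanAct η (R D p) D _ := not_not.1 fun hn => hspec.2 (hAB D _ hn)
    exact hact.of_agree fun j hj => by simp [hj]

end MeasurableSequencing

/-! ### A causal equivalent -/

namespace TeamSystem

variable {N : ℕ} {U : Fin N → Type u} {Y : Fin N → Type v} {Ω₀ : Type w₀}
  [∀ i, MeasurableSpace (U i)] [∀ i, MeasurableSpace (Y i)] [MeasurableSpace Ω₀]

/-- A measurable set that depends only on `ω` and the actions of the decision makers in `s` belongs
to `ℱ(s)`. -/
theorem measurableSet_cylField [∀ i, Nonempty (U i)] {S : TeamSystem.{u, v, w, w₀} U Y Ω₀} {k : ℕ}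
    (s : AgentOrder N k) {W : Set (S.Ω × (∀ j, U j))} (hW : MeasurableSet W)
    (hinv : ∀ ω u u', (∀ i, u' (s i) = u (s i)) → ((ω, u') ∈ W ↔ (ω, u) ∈ W)) :
    MeasurableSet[S.cylField s] W := by
  have hρ : ∀ j, ∃ ρ : (∀ i : Fin k, U (s i)) → U j, Measurable ρ ∧
      ∀ u : ∀ j, U j, (∃ i, s i = j) → ρ (fun i => u (s i)) = u j := by
    intro j
    by_cases hj : ∃ i, s i = j
    · obtain ⟨i, rfl⟩ := hj
      exact ⟨fun v => v i, measurable_pi_apply i, fun _ _ => rfl⟩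
    · exact ⟨fun _ => Classical.arbitrary _, measurable_const, fun _ h => absurd h hj⟩
  choose ρ hρm hρ using hρ
  refine ⟨(fun q : S.Ω × (∀ i : Fin k, U (s i)) => (q.1, fun j => ρ j q.2)) ⁻¹' W,
    (measurable_fst.prodMk (measurable_pi_iff.2 fun j => (hρm j).comp measurable_snd)) hW, ?_⟩
  ext ⟨ω, u⟩
  exact hinv ω u _ fun i => hρ _ u ⟨i, rfl⟩

/-- Property C holds as soon as the decision maker acting next is a measurable function of the
uncertainty and of the past actions. -/
theorem propertyC_of_measurable_next [∀ i, Nonempty (U i)] {S : TeamSystem.{u, v, w, w₀} U Y Ω₀}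
    (next : Finset (Fin N) → S.Ω × (∀ j, U j) → Fin N) (hm : ∀ D, Measurable (next D))
    (hinv : ∀ D ω u u', (∀ j ∈ D, u' j = u j) → next D (ω, u') = next D (ω, u))
    (hact : ∀ D, D ≠ Finset.univ → ∀ p, next D p ∉ D ∧ CanAct S.η p D (next D p)) :
    S.PropertyC := by
  refine ⟨fun p => greedyOrder (fun D => next D p) fun D hD => (hact D hD p).1,
    fun k hk s E hE => ?_⟩
  obtain ⟨H, hH, rfl⟩ := hE
  simp only [trunc_greedyOrder_eq_iff]
  have hpred : ∀ j : Fin (k + 1), ∀ i ∈ predecessors s j,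
      ∃ l : Fin k, s.trunc (Nat.le_succ k) l = i := by
    intro j i hi
    obtain ⟨l, hl, rfl⟩ := mem_predecessors.1 hi
    exact ⟨⟨l, by have := Fin.lt_def.1 hl; omega⟩, rfl⟩
  refine measurableSet_cylField _ ?_ fun ω u u' hu => ?_
  · refine (S.measurable_η _ hH).inter ?_
    rw [Set.ofPred_forall]
    exact .iInter fun j => hm _ (measurableSet_singleton (s j))
  · have hu' : ∀ j, ∀ i ∈ predecessors s j, u' i = u i := fun j i hi => by
      obtain ⟨l, rfl⟩ := hpred j i hi
      exact hu l
    have hnext : ∀ j, next (predecessors s j) (ω, u') = next (predecessors s j) (ω, u) :=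
      fun j => hinv _ _ _ _ (hu' j)
    simp only [Set.mem_inter_iff, Set.mem_preimage, Set.mem_ofPred_eq, hnext]
    refine and_congr_left fun hs => ?_
    have hlast := (hact _ (predecessors_ne_univ s (Fin.last k)) (ω, u)).2
    rw [hs] at hlast
    rw [hlast u' (hu' _)]

/-- Systems that differ only in their measurement functions, and only on a null set of the event
space, are equivalent as soon as both are solvable. -/
theorem equivalent_of_ae_eq {S : TeamSystem.{u, v, w, w₀} U Y Ω₀}
    {η' : ∀ i, S.Ω × (∀ j, U j) → Y i} (hη' : ∀ i, Measurable (η' i))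
    (hae : ∀ᵐ ω ∂S.P, ∀ i u, η' i (ω, u) = S.η i (ω, u)) (hS : S.PropertySM)
    (hS' : PropertySM { S with η := η', measurable_η := hη' }) :
    S.Equivalent { S with η := η', measurable_η := hη' } := by
  refine ⟨rfl, fun γ => ?_⟩
  obtain ⟨M, hM⟩ := hS γ
  obtain ⟨M', hM'⟩ := hS' γ
  have hMM : ∀ᵐ ω ∂S.P, M' ω = M ω := by
    filter_upwards [hae] with ω hω
    refine (hM.2 ω _).1 fun i => ?_
    rw [← hω]
    exact (hM'.2 ω _).2 rfl i
  refine ⟨M, M', hM, hM', Measure.map_congr ?_, lintegral_congr_ae ?_⟩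
  · filter_upwards [hae, hMM] with ω hω hω'
    simp only [hω', hω]
  · filter_upwards [hMM] with ω hω'
    simp only [hω']

/-- A causally implementable system becomes causal after a change of the measurement functions over a
null set of the event space. -/
theorem PropertyCI.exists_equivalent_propertyC [∀ i, StandardBorelSpace (U i)]
    [∀ i, Nonempty (U i)] [∀ i, StandardBorelSpace (Y i)] {S : TeamSystem.{u, v, w, w₀} U Y Ω₀}
    (h : S.PropertyCI) : ∃ S' : TeamSystem.{u, v, w, w₀} U Y Ω₀, S.Equivalent S' ∧ S'.PropertyC := by
  have hseq := h.sequenceable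
  have hSM := (propertyDF_of_sequenceable hseq).propertySM
  -- Without decision makers there is nobody to act next, but Property C is void.
  rcases isEmpty_or_nonempty (Fin N) with hN | hN
  · have hae : ∀ᵐ ω ∂S.P, ∀ i u, S.η i (ω, u) = S.η i (ω, u) := .of_forall fun _ _ _ => rfl
    exact ⟨S, equivalent_of_ae_eq S.measurable_η hae hSM hSM,
      fun _ => Function.Embedding.refl _, fun k hk s => isEmptyElim (s 0)⟩
  have : PolishSpace Bool := inferInstance
  choose τ hτb hτp using fun j => (inferInstance : StandardBorelSpace (U j)).polish
  have : Nonempty (∀ i, Y i) := by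
    obtain ⟨ω⟩ := S.P.nonempty_of_neZero
    exact ⟨fun i => S.η i (ω, fun _ => Classical.arbitrary _)⟩
  obtain ⟨f, hf, g, hg, hfg⟩ :=
    (measurable_pi_iff.2 S.measurable_η :
      Measurable fun p i => S.η i p).exists_eq_comp_prodMap_natBool
  have hfg' : ∀ i ω u, S.η i (ω, u) = g (f ω, u) i := fun i ω u => congrFun (congrFun hfg (ω, u)) i
  let κ : ∀ i, (ℕ → Bool) × (∀ j, U j) → Y i := fun i q => g q i
  have hκ : ∀ i, Measurable (κ i) := measurable_pi_iff.1 hg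
  have hκf : ∀ ω, Sequenceable κ (f ω) := by
    intro ω u D hD
    obtain ⟨i, hi, hact⟩ := hseq ω u D hD
    refine ⟨i, hi, fun b hb => ?_⟩
    have := hact b hb
    rwa [hfg', hfg'] at this
  -- The deadlocked states of the Cantor space form an analytic set that `f` never meets.
  set A : Set (ℕ → Bool) := {x | ¬ Sequenceable κ x} with hA
  have : IsProbabilityMeasure (S.P.map f) := Measure.isProbabilityMeasure_map hf.aemeasurable
  have hA0 : S.P.map f A = 0 :=
    (analyticSet_not_sequenceable hκ).measure_eq_zero_of_isCompact fun K hKA hK => by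
      rw [Measure.map_apply hf hK.measurableSet, Set.eq_empty_of_forall_notMem
        (s := f ⁻¹' K) fun ω hω => hKA hω (hκf ω), measure_empty]
  set T := toMeasurable (S.P.map f) A with hT
  have hTm : MeasurableSet T := measurableSet_toMeasurable _ _
  have hT0 : S.P (f ⁻¹' T) = 0 := by
    rw [← Measure.map_apply hf hTm, measure_toMeasurable, hA0]
  obtain ⟨x₀, hx₀⟩ : ∃ x₀, x₀ ∉ T := by
    by_contra! hall
    rw [Set.eq_univ_of_forall (s := f ⁻¹' T) fun ω => hall (f ω), measure_univ] at hT0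
    exact one_ne_zero hT0
  classical
  -- Retract the Cantor space onto a measurable set of states without deadlocks.
  let r : (ℕ → Bool) → ℕ → Bool := fun x => if x ∈ T then x₀ else x
  have hr : Measurable r := Measurable.ite hTm measurable_const measurable_id
  have hrA : ∀ x, Sequenceable κ (r x) := by
    intro x
    by_contra hx
    have hmem : r x ∈ T := subset_toMeasurable _ _ hx
    by_cases hxT : x ∈ T
    · exact hx₀ (by simpa only [r, hxT, if_true] using hmem)
    · simp only [r, hxT, if_false] at hmem
  obtain ⟨next, hm, hinv, hact⟩ := exists_measurable_next
    (η := fun i q => κ i (r q.1, q.2))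
    (fun i => (hκ i).comp ((hr.comp measurable_fst).prodMk measurable_snd)) (fun x => hrA x)
  let η' : ∀ i, S.Ω × (∀ j, U j) → Y i := fun i p => κ i (r (f p.1), p.2)
  have hη' : ∀ i, Measurable (η' i) := fun i =>
    (hκ i).comp (((hr.comp hf).comp measurable_fst).prodMk measurable_snd)
  have hae : ∀ᵐ ω ∂S.P, ∀ i u, η' i (ω, u) = S.η i (ω, u) := by
    filter_upwards [compl_mem_ae_iff.2 hT0] with ω hω i u
    have hω' : f ω ∉ T := hω
    simp [η', r, hω', hfg', κ]
  refine ⟨{ S with η := η', measurable_η := hη' }, equivalent_of_ae_eq hη' hae hSM ?_, ?_⟩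
  · exact (propertyDF_of_sequenceable (S := { S with η := η', measurable_η := hη' })
      fun ω => hrA (f ω)).propertySM
  · exact propertyC_of_measurable_next (fun D p => next D (f p.1, p.2))
      (fun D => (hm D).comp ((hf.comp measurable_fst).prodMk measurable_snd))
      (fun D ω u u' hu => hinv D _ _ _ hu) fun D hD p => hact D hD (f p.1, p.2)

end TeamSystem

/-! ### The relations between the properties -/

theorem mainTheorem1 {N : ℕ} {U : Fin N → Type u} {Y : Fin N → Type v} {Ω₀ : Type w₀}
    [∀ i, MeasurableSpace (U i)] [∀ i, StandardBorelSpace (U i)] [∀ i, Nonempty (U i)]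
    [∀ i, MeasurableSpace (Y i)] [∀ i, StandardBorelSpace (Y i)] [MeasurableSpace Ω₀]
    (S : TeamSystem.{u, v, w, w₀} U Y Ω₀) :
    (S.PropertyCI → ∃ S' : TeamSystem.{u, v, w, w₀} U Y Ω₀, S.Equivalent S' ∧ S'.PropertyC) ∧
      (S.PropertyC → S.PropertyCI) ∧
      (S.PropertyCI ↔ S.PropertyDF) ∧
      (S.PropertyDF → S.PropertySM) :=
  ⟨fun h => h.exists_equivalent_propertyC, fun h => h.propertyCI,
    ⟨fun h => TeamSystem.propertyDF_of_sequenceable h.sequenceable,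
      fun h => TeamSystem.propertyCI_of_sequenceable h.sequenceable⟩, fun h => h.propertySM⟩
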